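/- Let $k\ge 1$ and let $\Delta=(\mathbf p_0,\dots,\mathbf p_k)$ be an ordered $(k+1)$-tuple of affinely independent points of $\mathbb R^k$ (a non-degenerate simplex). Definitions. For $n\ge 1$ let $C_n(\mathbb R^k)$ be the space of $n$-tuples of distinct points of $\mathbb R^k$. For $\mathbf p\in C_n(\mathbb R^k)$ put $\pi_{ij}(\mathbf p)=\frac{\mathbf p_i-\mathbf p_j}{\|\mathbf p_i-\mathbf p_j\|}$ and $r_{ijl}(\mathbf p)=\frac{\|\mathbf p_i-\mathbf p_j\|}{\|\mathbf p_i-\mathbf p_l\|}$ (distinct indices), and let $\alpha_n(\mathbf p)=(\mathbf p,(\pi_{ij}(\mathbf p)),(r_{ijl}(\mathbf p)))\in A_n=(\mathbb R^k)^n\times(S^{k-1})^{n(n-1)}\times[0,\infty]^{n(n-1)(n-2)}$. For $M\subseteq\mathbb R^k$, $C_n[M]$ is the closure of $\alpha_n(C_n(\mathbb R^k)\cap M^n)$ in $M^n\times(S^{k-1})^{n(n-1)}\times[0,\infty]^{n(n-1)(n-2)}$; in particular $C_{k+1}[S^{k-1}]\subset C_{k+1}[\mathbb R^k]$ for the unit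 sphere $S^{k-1}\subset\mathbb R^k$. Let $\mathrm{Sim}(\Delta)\subset C_{k+1}[\mathbb R^k]$ be the closure of the set of all $\mathbf q\in C_{k+1}(\mathbb R^k)$ with $r_{ijl}(\mathbf q)=r_{ijl}(\Delta)$ for all distinct $i,j,l$. For a point $x\in C_{k+1}[\mathbb R^k]$ let $\Pi(x)$ be the $k\times k$ matrix with columns $\pi_{10}(x),\dots,\pi_{k0}(x)$ (the direction coordinates of $x$), and let $P(\Delta)=(\Pi(\Delta)^T\Pi(\Delta))^{1/2}$. The pose map $ps:\mathrm{Sim}(\Delta)\to O(k)$ sends $x$ to the unique orthogonal matrix $U$ with $\Pi(x)=U\,P(\Delta)$. Let $\mathrm{Sim}^+(\Delta)=ps^{-1}(SO(k))$, $\mathrm{Sim}^-(\Delta)=\mathrm{Sim}(\Delta)\setminus \mathrm{Sim}^+(\Delta)$, and $d=k(k-1)/2$. A top class of a closed $d$-manifold $M$ is a class in $H_d(M;\mathbb Z)$ whose image in $H_d(M,M\setminus\{x\};\mathbb Z)\cong\mathbb Z$ is a generator for every $x\in M$. Statement. (1) The pose map $ps:\mathrm{Sim}(\Delta)\cap C_{k+1}[S^{k-1}]\to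 O(k)$ and the inclusion $\mathrm{Sim}(\Delta)\cap C_{k+1}[S^{k-1}]\hookrightarrow \mathrm{Sim}(\Delta)$ induce isomorphisms on integral singular homology in every degree; in particular $H_*(O(k);\mathbb Z)\cong H_*(\mathrm{Sim}(\Delta)\cap C_{k+1}[S^{k-1}];\mathbb Z)$. (2) The intersection $X^+=\mathrm{Sim}^+(\Delta)\cap C_{k+1}[S^{k-1}]$ lies in the open configuration space $C_{k+1}(\mathbb R^k)$ and is a smooth $d$-dimensional submanifold of it, as is $SO(k)$ of the space of $k\times k$ matrices, and $ps:X^+\to SO(k)$ is a diffeomorphism. It induces an isomorphism on integral homology, as does the inclusion $\iota: X^+\hookrightarrow \mathrm{Sim}^+(\Delta)$, and it takes the top class of $X^+$ in $\mathrm{Sim}^+(\Delta)$ to the top class of $SO(k)$: for $c\in H_d(X^+;\mathbb Z)$, $c$ is a top class of $X^+$ if and only if $ps_*(\iota_*c)\in H_d(SO(k);\mathbb Z)$ is a top class of $SO(k)$. (3) The same holds for $X^-=\mathrm{Sim}^-(\Delta)\cap C_{k+1}[S^{k-1}]$, with $\mathrm{Sim}^-(\Delta)$ in place of $\mathrm{Sim}^+(\Delta)$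 and $O(k)\setminus SO(k)$ in place of $SO(k)$. -/

import Mathlib

open CategoryTheory AlgebraicTopology Limits Topology
open scoped ContDiff ENNReal MatrixOrder

noncomputable section

namespace InscribedSimplex

/-- Euclidean space `ℝ^k`. -/
abbrev E (k : ℕ) : Type := EuclideanSpace ℝ (Fin k)

/-! ### Configuration spaces and their compactifications -/

/-- The open configuration space `C_n(ℝ^k)` of ordered `n`-tuples of distinct points. -/
abbrev Conf (n k : ℕ) : Type := {p : Fin n → E k // Function.Injective p}

/-- Ordered pairs of distinct indices. -/
abbrev Pairs (n : ℕ) : Type := {t : Fin n × Fin n // t.1 ≠ t.2}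

/-- Ordered triples of pairwise distinct indices. -/
abbrev Triples (n : ℕ) : Type :=
  {t : Fin n × Fin n × Fin n // t.1 ≠ t.2.1 ∧ t.2.1 ≠ t.2.2 ∧ t.1 ≠ t.2.2}

/-- The product `A_n[ℝ^k] = (ℝ^k)^n × (S^{k-1})^{n(n-1)} × [0,∞]^{n(n-1)(n-2)}`. -/
abbrev Amb (n k : ℕ) : Type :=
  (Fin n → E k) × (Pairs n → Metric.sphere (0 : E k) 1) × (Triples n → ℝ≥0∞)

/-- The position coordinates of a point of `A_n[ℝ^k]`. -/
def pos {n k : ℕ} (x : Amb n k) : Fin n → E k := x.1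

/-- The unit vector `π_{ij}(p) = (p_i - p_j) / ‖p_i - p_j‖`. -/
def dir {n k : ℕ} (p : Conf n k) (t : Pairs n) : Metric.sphere (0 : E k) 1 :=
  ⟨‖p.1 t.1.1 - p.1 t.1.2‖⁻¹ • (p.1 t.1.1 - p.1 t.1.2), by
    have h : p.1 t.1.1 - p.1 t.1.2 ≠ 0 := sub_ne_zero.2 fun h => t.2 (p.2 h)
    rw [mem_sphere_zero_iff_norm, norm_smul, norm_inv, norm_norm,
      inv_mul_cancel₀ (norm_ne_zero_iff.2 h)]⟩

/-- The ratio `r_{ijl}(p) = ‖p_i - p_j‖ / ‖p_i - p_l‖`, as an element of `[0,∞]`. -/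
def ratio {n k : ℕ} (p : Conf n k) (t : Triples n) : ℝ≥0∞ :=
  ENNReal.ofReal (‖p.1 t.1.1 - p.1 t.1.2.1‖ / ‖p.1 t.1.1 - p.1 t.1.2.2‖)

/-- The map `α_n : C_n(ℝ^k) → A_n[ℝ^k]`. -/
def alpha {n k : ℕ} (p : Conf n k) : Amb n k := (p.1, dir p, ratio p)

/-- The compactified configuration space `C_n[M]` of a subset `M ⊆ ℝ^k`: the closure of
`C_n(M)` in `M^n × (S^{k-1})^{n(n-1)} × [0,∞]^{n(n-1)(n-2)}`. -/
def compactConf (n : ℕ) {k : ℕ} (M : Set (E k)) : Set (Amb n k) :=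
  {x | x ∈ closure (alpha '' {p : Conf n k | ∀ i, p.1 i ∈ M}) ∧ ∀ i, pos x i ∈ M}

/-- `C_{k+1}[S^{k-1}]` for the standard unit sphere of `ℝ^k`. -/
def sphereConf (k : ℕ) : Set (Amb (k + 1) k) := compactConf (k + 1) (Metric.sphere (0 : E k) 1)

/-! ### Similar simplices and the pose map -/

/-- The simplices similar to `Δ` in the open configuration space. -/
def simOpen {k : ℕ} (Δ : Conf (k + 1) k) : Set (Conf (k + 1) k) :=
  {q | ∀ t, ratio q t = ratio Δ t}

/-- `Sim(Δ)` as a closed subspace (with boundary) of `C_{k+1}[ℝ^k]`: the closure of the set of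
nondegenerate simplices similar to `Δ`. As `C_{k+1}[ℝ^k]` is closed in the ambient product, the
closure can be taken there. -/
def sim {k : ℕ} (Δ : Conf (k + 1) k) : Set (Amb (k + 1) k) := closure (alpha '' simOpen Δ)

/-- The matrix `Π(x) = [π_{10}(x) ⋯ π_{k0}(x)]`, whose columns are unit vectors. -/
def Pi {k : ℕ} (x : Amb (k + 1) k) : Matrix (Fin k) (Fin k) ℝ :=
  Matrix.of fun a j => (x.2.1 ⟨(j.succ, 0), Fin.succ_ne_zero j⟩ : E k) a

/-- `P(Δ) = (Π(Δ)ᵀ Π(Δ))^{1/2}`, the positive semidefinite square root. -/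
def P {k : ℕ} (Δ : Conf (k + 1) k) : Matrix (Fin k) (Fin k) ℝ :=
  CFC.sqrt ((Pi (alpha Δ)).transpose * Pi (alpha Δ))

/-- The pose `U(x) = Π(x) P(Δ)⁻¹`. For `x ∈ Sim(Δ)` it is the unique orthogonal matrix `U` with
`Π(x) = U P(Δ)`: see `pose_mul_P` and `pose_mem_orthogonalGroup`. -/
def pose {k : ℕ} (Δ : Conf (k + 1) k) (x : Amb (k + 1) k) : Matrix (Fin k) (Fin k) ℝ :=
  Pi x * (P Δ)⁻¹

theorem continuous_Pi {k : ℕ} : Continuous (Pi : Amb (k + 1) k → Matrix (Fin k) (Fin k) ℝ) := by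
  unfold Pi
  refine continuous_matrix fun a j => ?_
  simp only [Matrix.of_apply]
  fun_prop

theorem continuous_pose {k : ℕ} (Δ : Conf (k + 1) k) : Continuous (pose Δ) :=
  continuous_Pi.matrix_mul continuous_const

theorem Pi_transpose_mul_apply {k : ℕ} (x : Amb (k + 1) k) (i j : Fin k) :
    ((Pi x).transpose * Pi x) i j =
      inner ℝ (x.2.1 ⟨(i.succ, 0), Fin.succ_ne_zero i⟩ : E k)
        (x.2.1 ⟨(j.succ, 0), Fin.succ_ne_zero j⟩ : E k) := by
  simp [Matrix.mul_apply, Pi, PiLp.inner_apply, mul_comm]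

theorem ratio_toReal {n k : ℕ} (p : Conf n k) (t : Triples n) :
    (ratio p t).toReal = ‖p.1 t.1.1 - p.1 t.1.2.1‖ / ‖p.1 t.1.1 - p.1 t.1.2.2‖ :=
  ENNReal.toReal_ofReal (by positivity)

/-- The law of cosines, in terms of the ratios. -/
theorem inner_dir {k : ℕ} (q : Conf (k + 1) k) (i j : Fin k) (hij : i ≠ j) :
    inner ℝ (dir q ⟨(i.succ, 0), Fin.succ_ne_zero i⟩ : E k)
        (dir q ⟨(j.succ, 0), Fin.succ_ne_zero j⟩ : E k) =
      ((ratio q ⟨(0, i.succ, j.succ), (Fin.succ_ne_zero i).symm,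
          fun h => hij (Fin.succ_injective k h), (Fin.succ_ne_zero j).symm⟩).toReal +
        (ratio q ⟨(0, j.succ, i.succ), (Fin.succ_ne_zero j).symm,
          fun h => hij (Fin.succ_injective k h).symm, (Fin.succ_ne_zero i).symm⟩).toReal -
        (ratio q ⟨(i.succ, j.succ, 0), fun h => hij (Fin.succ_injective k h),
          Fin.succ_ne_zero j, Fin.succ_ne_zero i⟩).toReal *
        (ratio q ⟨(j.succ, i.succ, 0), fun h => hij (Fin.succ_injective k h).symm,
          Fin.succ_ne_zero i, Fin.succ_ne_zero j⟩).toReal) / 2 := by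
  simp only [ratio_toReal, dir, inner_smul_left, inner_smul_right]
  have hi : ‖q.1 i.succ - q.1 0‖ ≠ 0 :=
    norm_ne_zero_iff.2 (sub_ne_zero.2 fun h => Fin.succ_ne_zero i (q.2 h))
  have hj : ‖q.1 j.succ - q.1 0‖ ≠ 0 :=
    norm_ne_zero_iff.2 (sub_ne_zero.2 fun h => Fin.succ_ne_zero j (q.2 h))
  have h := norm_sub_sq_real (q.1 i.succ - q.1 0) (q.1 j.succ - q.1 0)
  rw [sub_sub_sub_cancel_right] at h
  rw [norm_sub_rev (q.1 0) (q.1 i.succ), norm_sub_rev (q.1 0) (q.1 j.succ),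
    norm_sub_rev (q.1 j.succ) (q.1 i.succ)]
  simp only [conj_trivial]
  field_simp
  linarith

/-- All points of `Sim(Δ)` have the same Gram matrix. -/
theorem gram_eq {k : ℕ} (Δ : Conf (k + 1) k) {x : Amb (k + 1) k} (hx : x ∈ sim Δ) :
    (Pi x).transpose * Pi x = (Pi (alpha Δ)).transpose * Pi (alpha Δ) := by
  have hc : IsClosed {x : Amb (k + 1) k |
      (Pi x).transpose * Pi x = (Pi (alpha Δ)).transpose * Pi (alpha Δ)} :=
    isClosed_eq (continuous_Pi.matrix_transpose.matrix_mul continuous_Pi) continuous_const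
  refine closure_minimal ?_ hc hx
  rintro _ ⟨q, hq, rfl⟩
  ext i j
  rw [Pi_transpose_mul_apply, Pi_transpose_mul_apply]
  by_cases hij : i = j
  · subst hij
    simp
  · change inner ℝ (dir q _ : E k) (dir q _ : E k) = inner ℝ (dir Δ _ : E k) (dir Δ _ : E k)
    rw [inner_dir q i j hij, inner_dir Δ i j hij, hq, hq, hq, hq]

theorem P_mul_P {k : ℕ} (Δ : Conf (k + 1) k) :
    P Δ * P Δ = (Pi (alpha Δ)).transpose * Pi (alpha Δ) := by
  refine CFC.sqrt_mul_sqrt_self _ ?_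
  rw [Matrix.nonneg_iff_posSemidef]
  simpa using Matrix.posSemidef_conjTranspose_mul_self (Pi (alpha Δ))

theorem P_transpose {k : ℕ} (Δ : Conf (k + 1) k) : (P Δ).transpose = P Δ := by
  have h : (P Δ).PosSemidef := Matrix.nonneg_iff_posSemidef.1 (CFC.sqrt_nonneg _)
  simpa using h.1.eq

theorem det_Pi_ne_zero {k : ℕ} (Δ : Conf (k + 1) k) (hΔ : AffineIndependent ℝ Δ.1) :
    (Pi (alpha Δ)).det ≠ 0 := by
  have h1 := (affineIndependent_iff_linearIndependent_vsub ℝ Δ.1 0).1 hΔ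
  have h2 : LinearIndependent ℝ fun j : Fin k => Δ.1 j.succ - Δ.1 0 :=
    h1.comp (fun j : Fin k => ⟨j.succ, Fin.succ_ne_zero j⟩)
      fun a b h => Fin.succ_injective k (congrArg Subtype.val h)
  have h3 : LinearIndependent ℝ fun j : Fin k =>
      ‖Δ.1 j.succ - Δ.1 0‖⁻¹ • (Δ.1 j.succ - Δ.1 0) := by
    have hne : ∀ j : Fin k, ‖Δ.1 j.succ - Δ.1 0‖⁻¹ ≠ 0 := fun j =>
      inv_ne_zero (norm_ne_zero_iff.2 (sub_ne_zero.2 fun h => Fin.succ_ne_zero j (Δ.2 h)))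
    exact h2.units_smul fun j => Units.mk0 _ (hne j)
  have h4 := h3.map' (WithLp.linearEquiv 2 ℝ (Fin k → ℝ)).toLinearMap (LinearEquiv.ker _)
  have h5 : LinearIndependent ℝ (Pi (alpha Δ)).col := h4
  have h6 := Matrix.linearIndependent_cols_iff_isUnit.1 h5
  exact ((Matrix.isUnit_iff_isUnit_det _).1 h6).ne_zero

theorem isUnit_det_P {k : ℕ} (Δ : Conf (k + 1) k) (hΔ : AffineIndependent ℝ Δ.1) :
    IsUnit (P Δ).det := by
  have h := congrArg Matrix.det (P_mul_P Δ)
  rw [Matrix.det_mul, Matrix.det_mul, Matrix.det_transpose] at h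
  refine isUnit_iff_ne_zero.2 fun h0 => ?_
  rw [h0, zero_mul] at h
  exact mul_self_ne_zero.2 (det_Pi_ne_zero Δ hΔ) h.symm

/-- The polar decomposition `Π(x) = U(x) P(Δ)`. -/
theorem pose_mul_P {k : ℕ} (Δ : Conf (k + 1) k) (hΔ : AffineIndependent ℝ Δ.1)
    (x : Amb (k + 1) k) : pose Δ x * P Δ = Pi x := by
  rw [pose, Matrix.mul_assoc, Matrix.nonsing_inv_mul _ (isUnit_det_P Δ hΔ), Matrix.mul_one]

theorem pose_mem_orthogonalGroup {k : ℕ} (Δ : Conf (k + 1) k) (hΔ : AffineIndependent ℝ Δ.1)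
    {x : Amb (k + 1) k} (hx : x ∈ sim Δ) : pose Δ x ∈ Matrix.orthogonalGroup (Fin k) ℝ := by
  have hu := isUnit_det_P Δ hΔ
  rw [Matrix.mem_orthogonalGroup_iff']
  change (Pi x * (P Δ)⁻¹).transpose * (Pi x * (P Δ)⁻¹) = 1
  rw [Matrix.transpose_mul, Matrix.transpose_nonsing_inv, P_transpose, Matrix.mul_assoc,
    ← Matrix.mul_assoc (Pi x).transpose, gram_eq Δ hx, ← P_mul_P, Matrix.mul_assoc,
    Matrix.mul_nonsing_inv _ hu, Matrix.mul_one, Matrix.nonsing_inv_mul _ hu]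

/-- `O(k)` as a subspace of the space of matrices. -/
def O (k : ℕ) : Set (Matrix (Fin k) (Fin k) ℝ) := Matrix.orthogonalGroup (Fin k) ℝ

/-- `SO(k)` as a subspace of the space of matrices. -/
def SO (k : ℕ) : Set (Matrix (Fin k) (Fin k) ℝ) := Matrix.specialOrthogonalGroup (Fin k) ℝ

/-- `Sim⁺(Δ)`: the similar simplices whose pose is a rotation. -/
def simPlus {k : ℕ} (Δ : Conf (k + 1) k) : Set (Amb (k + 1) k) :=
  {x | x ∈ sim Δ ∧ pose Δ x ∈ SO k}

/-- `Sim⁻(Δ) = Sim(Δ) \ Sim⁺(Δ)`. -/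
def simMinus {k : ℕ} (Δ : Conf (k + 1) k) : Set (Amb (k + 1) k) := sim Δ \ simPlus Δ

theorem mapsTo_pose {k : ℕ} (Δ : Conf (k + 1) k) (hΔ : AffineIndependent ℝ Δ.1) :
    Set.MapsTo (pose Δ) (sim Δ) (O k) := fun _ hx => pose_mem_orthogonalGroup Δ hΔ hx

theorem mapsTo_pose_plus {k : ℕ} (Δ : Conf (k + 1) k) :
    Set.MapsTo (pose Δ) (simPlus Δ) (SO k) := fun _ hx => hx.2

theorem mapsTo_pose_minus {k : ℕ} (Δ : Conf (k + 1) k) (hΔ : AffineIndependent ℝ Δ.1) :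
    Set.MapsTo (pose Δ) (simMinus Δ) (O k \ SO k) :=
  fun _ hx => ⟨pose_mem_orthogonalGroup Δ hΔ hx.1, fun h => hx.2 ⟨hx.1, h⟩⟩

/-- The pose map as a continuous map from a subspace `Y` to a space of matrices `T`. -/
def poseMap {k : ℕ} (Δ : Conf (k + 1) k) {Y : Set (Amb (k + 1) k)}
    {T : Set (Matrix (Fin k) (Fin k) ℝ)} (h : Set.MapsTo (pose Δ) Y T) : C(Y, T) :=
  ⟨h.restrict, (continuous_pose Δ).continuousOn.mapsToRestrict h⟩

/-- The inclusion of the inscribed configurations `Y ∩ C_{k+1}[S^{k-1}]` in `Y`. -/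
def incl {k : ℕ} (Y : Set (Amb (k + 1) k)) : C((Y ∩ sphereConf k : Set (Amb (k + 1) k)), Y) :=
  ⟨Set.inclusion Set.inter_subset_left, continuous_inclusion Set.inter_subset_left⟩

/-! ### Integral singular homology and fundamental classes -/

/-- The integral singular chain complex. -/
abbrev chains (X : Type) [TopologicalSpace X] : ChainComplex (ModuleCat.{0} ℤ) ℕ :=
  ((singularChainComplexFunctor (ModuleCat.{0} ℤ)).obj (ModuleCat.of ℤ ℤ)).obj (TopCat.of X)

/-- The chain map induced by a continuous map. -/
abbrev chainsMap {X Y : Type} [TopologicalSpace X] [TopologicalSpace Y] (f : C(X, Y)) :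
    chains X ⟶ chains Y :=
  ((singularChainComplexFunctor (ModuleCat.{0} ℤ)).obj (ModuleCat.of ℤ ℤ)).map (TopCat.ofHom f)

/-- Integral singular homology `H_n(X; ℤ)`. -/
abbrev H (n : ℕ) (X : Type) [TopologicalSpace X] : ModuleCat.{0} ℤ :=
  ((singularHomologyFunctor (ModuleCat.{0} ℤ) n).obj (ModuleCat.of ℤ ℤ)).obj (TopCat.of X)

/-- The map `f_*` induced by a continuous map on integral homology. -/
abbrev Hmap (n : ℕ) {X Y : Type} [TopologicalSpace X] [TopologicalSpace Y] (f : C(X, Y)) :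
    H n X ⟶ H n Y :=
  ((singularHomologyFunctor (ModuleCat.{0} ℤ) n).obj (ModuleCat.of ℤ ℤ)).map (TopCat.ofHom f)

/-- The relative singular chain complex of `(X, A)`. -/
def relChains (X : Type) [TopologicalSpace X] (A : Set X) : ChainComplex (ModuleCat.{0} ℤ) ℕ :=
  cokernel (chainsMap (⟨Subtype.val, continuous_subtype_val⟩ : C(A, X)))

/-- The natural map `H_n(X; ℤ) → H_n(X, A; ℤ)`. -/
def toRel (n : ℕ) (X : Type) [TopologicalSpace X] (A : Set X) :
    H n X ⟶ (relChains X A).homology n :=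
  HomologicalComplex.homologyMap
    (cokernel.π (chainsMap (⟨Subtype.val, continuous_subtype_val⟩ : C(A, X)))) n

/-- `c ∈ H_d(M; ℤ)` is a top class (fundamental class) of the closed `d`-manifold `M`: its image
in the local homology `H_d(M, M \ {x}; ℤ) ≅ ℤ` is a generator for every `x`. -/
def IsTopClass (d : ℕ) (M : Type) [TopologicalSpace M] (c : H d M) : Prop :=
  ∀ x : M, Submodule.span ℤ {(toRel d M {x}ᶜ).hom c} = ⊤

/-! ### Submanifolds of Euclidean space and diffeomorphisms between them -/

section Smooth

variable {M N F G : Type} [NormedAddCommGroup F] [NormedSpace ℝ F]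
  [NormedAddCommGroup G] [NormedSpace ℝ G]

/-- `e : M → F` identifies the space `M` with a `d`-dimensional smooth submanifold of the
normed space `F`: it is a topological embedding, and near each point its image is parametrized by
an open set `V` of `ℝ^d` through a smooth map `ψ` whose inverse is the restriction of a smooth
map `φ` defined on an open set of `F`. -/
def IsSmoothSubmanifold (d : ℕ) [TopologicalSpace M] (e : M → F) : Prop :=
  IsEmbedding e ∧ ∀ x : M, ∃ U : Set F, IsOpen U ∧ e x ∈ U ∧
    ∃ V : Set (E d), IsOpen V ∧ ∃ (ψ : E d → F) (φ : F → E d),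
      ContDiffOn ℝ ∞ ψ V ∧ ContDiffOn ℝ ∞ φ U ∧
      ψ '' V = Set.range e ∩ U ∧ ∀ v ∈ V, φ (ψ v) = v

/-- `f : M → N` is smooth with respect to `e : M → F` and `e' : N → G`: near every point it is the
restriction of a smooth map defined on an open set of `F`. -/
def IsSmoothMap (e : M → F) (e' : N → G) (f : M → N) : Prop :=
  ∀ x : M, ∃ U : Set F, IsOpen U ∧ e x ∈ U ∧ ∃ g : F → G, ContDiffOn ℝ ∞ g U ∧
    ∀ y : M, e y ∈ U → e' (f y) = g (e y)

/-- `f : M → N` is a bijection, smooth with smooth inverse. -/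
def IsDiffeo (e : M → F) (e' : N → G) (f : M → N) : Prop :=
  IsSmoothMap e e' f ∧
    ∃ g : N → M, Function.LeftInverse g f ∧ Function.RightInverse g f ∧ IsSmoothMap e' e g

end Smooth

/-- The entries of a matrix, as a point of a normed space. -/
def entries {k : ℕ} {T : Set (Matrix (Fin k) (Fin k) ℝ)} (A : T) : Fin k → Fin k → ℝ :=
  fun i j => A.1 i j

/-- The smooth coordinates of a configuration, for spaces of configurations of distinct points:
the positions of the points. -/
def positions {n k : ℕ} {X : Set (Amb n k)} (x : X) : Fin n → E k := pos x.1

/-- The assertions on the pose map `Y ∩ C_{k+1}[S^{k-1}] → T` for a part `Y` of `Sim(Δ)`. -/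
structure PoseResult {k : ℕ} (Δ : Conf (k + 1) k) (Y : Set (Amb (k + 1) k))
    (T : Set (Matrix (Fin k) (Fin k) ℝ)) (h : Set.MapsTo (pose Δ) Y T) : Prop where
  /-- The intersection lies in the open configuration space `C_{k+1}(ℝ^k)`, where the positions
  of the points are smooth coordinates. -/
  subset_interior : Y ∩ sphereConf k ⊆ Set.range alpha
  /-- The intersection is a smooth submanifold of dimension `k(k-1)/2`. -/
  source_manifold : IsSmoothSubmanifold (k * (k - 1) / 2)
    (positions : (Y ∩ sphereConf k : Set (Amb (k + 1) k)) → Fin (k + 1) → E k)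
  /-- The target is a smooth submanifold of the space of matrices, of the same dimension. -/
  target_manifold : IsSmoothSubmanifold (k * (k - 1) / 2) (entries : T → Fin k → Fin k → ℝ)
  /-- The pose map is a diffeomorphism. -/
  diffeo : IsDiffeo positions entries
    (poseMap Δ (h.mono_left (Set.inter_subset_left (t := sphereConf k))))
  /-- The pose map induces an isomorphism on integral homology. -/
  homology_iso : ∀ n, IsIso (Hmap n
    (poseMap Δ (h.mono_left (Set.inter_subset_left (t := sphereConf k)))))
  /-- The inclusion of the intersection in `Y` induces an isomorphism on integral homology. -/
  incl_iso : ∀ n, IsIso (Hmap n (incl Y))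
  /-- The top classes of the intersection, taken in `Y`, correspond to the top classes of `T`. -/
  top_class : ∀ c : H (k * (k - 1) / 2) (Y ∩ sphereConf k : Set (Amb (k + 1) k)),
    IsTopClass _ _ c ↔
      IsTopClass _ _ ((Hmap _ (poseMap Δ h)).hom ((Hmap _ (incl Y)).hom c))

end InscribedSimplex

end

/-!
The simplex `Δ` is similar to a simplex `q` inscribed in the unit sphere whose pose is the identity.
Every point of `Sim(Δ)` is the image of `q` under a similarity `v ↦ a + s U v`, where `U` is its
pose, and the collapsed simplices are the case `s = 0`, in which the directions and ratios still
remember `U q`. Points of `C_{k+1}[S^{k-1}]` satisfy `⟪π_{ij}, p_i + p_j⟫ = 0`, also when `p_i` and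
`p_j` collide. On a similar image of `q` these relations say that `a` is orthogonal to the edge
directions, which span `ℝ^k`; hence `a = 0`, and then `s = 1`. So the inscribed part of `Sim(Δ)` is
parametrized by the pose, and letting `a` tend to `0` and `s` to `1` retracts `Sim(Δ)` onto it.
The smooth structure on `O(k)` comes from the Cayley transform.
-/

noncomputable section

namespace InscribedSimplex

/-! ### Homology of homotopic and homeomorphic spaces -/

section Homology

variable {X Y Z : Type} [TopologicalSpace X] [TopologicalSpace Y] [TopologicalSpace Z]

theorem Hmap_comp (n : ℕ) (f : C(X, Y)) (g : C(Y, Z)) :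
    Hmap n (g.comp f) = Hmap n f ≫ Hmap n g :=
  ((singularHomologyFunctor (ModuleCat.{0} ℤ) n).obj (ModuleCat.of ℤ ℤ)).map_comp
    (TopCat.ofHom f) (TopCat.ofHom g)

theorem Hmap_id (n : ℕ) : Hmap n (ContinuousMap.id X) = 𝟙 (H n X) :=
  ((singularHomologyFunctor (ModuleCat.{0} ℤ) n).obj (ModuleCat.of ℤ ℤ)).map_id (TopCat.of X)

theorem Hmap_eq_of_homotopic (n : ℕ) {f g : C(X, Y)} (h : f.Homotopic g) :
    Hmap n f = Hmap n g := by
  obtain ⟨F⟩ := h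
  have F' : TopCat.Homotopy (TopCat.ofHom f) (TopCat.ofHom g) := F
  exact F'.congr_homologyMap_singularChainComplexFunctor (ModuleCat.of ℤ ℤ) n

theorem isIso_Hmap_homotopyEquiv (n : ℕ) (e : ContinuousMap.HomotopyEquiv X Y) :
    IsIso (Hmap n e.toFun) :=
  ⟨Hmap n e.invFun, by rw [← Hmap_comp, Hmap_eq_of_homotopic n e.left_inv, Hmap_id],
    by rw [← Hmap_comp, Hmap_eq_of_homotopic n e.right_inv, Hmap_id]⟩

theorem isIso_Hmap_homeomorph (n : ℕ) (e : X ≃ₜ Y) : IsIso (Hmap n (e : C(X, Y))) :=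
  isIso_Hmap_homotopyEquiv n e.toHomotopyEquiv

/-- The isomorphism of singular chain complexes induced by a homeomorphism. -/
def chainsIso (e : X ≃ₜ Y) : chains X ≅ chains Y :=
  ((singularChainComplexFunctor (ModuleCat.{0} ℤ)).obj (ModuleCat.of ℤ ℤ)).mapIso
    (TopCat.isoOfHomeo e)

/-- The isomorphism of relative singular chain complexes induced by a homeomorphism of pairs
`(X, A) ≃ (Y, B)`. -/
def relChainsIso (e : X ≃ₜ Y) {A : Set X} {B : Set Y} (h : ∀ x, x ∈ A ↔ e x ∈ B) :
    relChains X A ≅ relChains Y B :=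
  cokernel.mapIso _ _ (chainsIso (e.subtype h)) (chainsIso e) (by
    simp only [chainsIso, Functor.mapIso_hom]
    rw [← Functor.map_comp, ← Functor.map_comp]
    rfl)

/-- The projection of the singular chains of `X` onto the relative chains of `(X, A)`, which
`toRel` applies to homology. -/
def relChainsProj (A : Set X) : chains X ⟶ relChains X A :=
  cokernel.π (chainsMap (⟨Subtype.val, continuous_subtype_val⟩ : C(A, X)))

theorem relChainsProj_comp_relChainsIso (e : X ≃ₜ Y) {A : Set X} {B : Set Y}
    (h : ∀ x, x ∈ A ↔ e x ∈ B) :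
    relChainsProj A ≫ (relChainsIso e h).hom = (chainsIso e).hom ≫ relChainsProj B :=
  cokernel.π_desc _ _ _

theorem toRel_comp_relChainsIso (n : ℕ) (e : X ≃ₜ Y) {A : Set X} {B : Set Y}
    (h : ∀ x, x ∈ A ↔ e x ∈ B) :
    toRel n X A ≫ HomologicalComplex.homologyMap (relChainsIso e h).hom n =
      Hmap n (e : C(X, Y)) ≫ toRel n Y B := by
  have hn := congrArg (HomologicalComplex.homologyMap · n) (relChainsProj_comp_relChainsIso e h)
  simp only [HomologicalComplex.homologyMap_comp] at hn
  exact hn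

theorem span_singleton_eq_top_iff_of_equiv {R M N : Type*} [Semiring R] [AddCommMonoid M]
    [AddCommMonoid N] [Module R M] [Module R N] (L : M ≃ₗ[R] N) (m : M) :
    Submodule.span R {L m} = ⊤ ↔ Submodule.span R {m} = ⊤ := by
  have h : Submodule.span R {L m} = (Submodule.span R {m}).map (L : M →ₗ[R] N) := by
    rw [Submodule.map_span, Set.image_singleton, LinearEquiv.coe_coe]
  rw [h, Submodule.map_eq_top_iff]

theorem isTopClass_Hmap_homeomorph_iff (d : ℕ) (e : X ≃ₜ Y) (c : H d X) :
    IsTopClass d Y ((Hmap d (e : C(X, Y))).hom c) ↔ IsTopClass d X c := by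
  refine e.surjective.forall.trans (forall_congr' fun x => ?_)
  have h : ∀ y, y ∈ ({x}ᶜ : Set X) ↔ e y ∈ ({e x}ᶜ : Set Y) := fun y =>
    not_congr e.injective.eq_iff.symm
  let L := (asIso (HomologicalComplex.homologyMap (relChainsIso e h).hom d)).toLinearEquiv
  have hL : L ((toRel d X {x}ᶜ).hom c) = (toRel d Y {e x}ᶜ).hom ((Hmap d (e : C(X, Y))).hom c) :=
    congrArg (fun f => f.hom c) (toRel_comp_relChainsIso d e h)
  rw [← hL, span_singleton_eq_top_iff_of_equiv]

end Homology

/-! ### Smooth matrix-valued functions -/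

section SmoothMatrix

variable {𝕜 F ι κ μ : Type*} [NontriviallyNormedField 𝕜] [NormedAddCommGroup F] [NormedSpace 𝕜 F]
  [Fintype κ] {U : Set F} {n : WithTop ℕ∞}

theorem contDiffOn_matrix_mul {R : Type*} [NormedRing R] [NormedAlgebra 𝕜 R]
    {M : F → Matrix ι κ R} {N : F → Matrix κ μ R}
    (hM : ∀ i j, ContDiffOn 𝕜 n (fun x => M x i j) U)
    (hN : ∀ i j, ContDiffOn 𝕜 n (fun x => N x i j) U) (i : ι) (j : μ) :
    ContDiffOn 𝕜 n (fun x => (M x * N x) i j) U := by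
  simp only [Matrix.mul_apply]
  exact ContDiffOn.sum fun l _ => (hM i l).mul (hN l j)

variable [DecidableEq κ]

theorem contDiffOn_matrix_det {R : Type*} [NormedCommRing R] [NormedAlgebra 𝕜 R]
    {M : F → Matrix κ κ R} (hM : ∀ i j, ContDiffOn 𝕜 n (fun x => M x i j) U) :
    ContDiffOn 𝕜 n (fun x => (M x).det) U := by
  simp only [Matrix.det_apply']
  exact ContDiffOn.sum fun σ _ => contDiffOn_const.mul (contDiffOn_prod fun l _ => hM _ _)

theorem contDiffOn_matrix_inv {𝕂 : Type*} [NormedField 𝕂] [NormedAlgebra 𝕜 𝕂]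
    {M : F → Matrix κ κ 𝕂} (hM : ∀ i j, ContDiffOn 𝕜 n (fun x => M x i j) U)
    (h0 : ∀ x ∈ U, (M x).det ≠ 0) (i j : κ) :
    ContDiffOn 𝕜 n (fun x => (M x)⁻¹ i j) U := by
  simp only [Matrix.inv_def, Matrix.smul_apply, Ring.inverse_eq_inv', smul_eq_mul,
    Matrix.adjugate_apply]
  refine ((contDiffOn_matrix_det hM).inv h0).mul (contDiffOn_matrix_det fun a b => ?_)
  by_cases h : a = j
  · subst h
    simpa using contDiffOn_const
  · simpa [Matrix.updateRow_ne h] using hM a b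

end SmoothMatrix

/-! ### The Cayley transform -/

section Cayley

variable {ι R : Type*} [Fintype ι] [DecidableEq ι]

/-- The Cayley transform `(1 - S)(1 + S)⁻¹`, an involution exchanging the skew-symmetric matrices
and the orthogonal matrices without the eigenvalue `-1`. The value is junk if `1 + S` is
singular. -/
def cayley [CommRing R] (S : Matrix ι ι R) : Matrix ι ι R := (1 - S) * (1 + S)⁻¹

theorem contDiffOn_cayley {𝕜 F 𝕂 : Type*} [NontriviallyNormedField 𝕜] [NormedAddCommGroup F]
    [NormedSpace 𝕜 F] [NormedField 𝕂] [NormedAlgebra 𝕜 𝕂] {n : WithTop ℕ∞} {U : Set F}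
    {M : F → Matrix ι ι 𝕂} (hM : ∀ i j, ContDiffOn 𝕜 n (fun x => M x i j) U)
    (h0 : ∀ x ∈ U, (1 + M x).det ≠ 0) (i j : ι) :
    ContDiffOn 𝕜 n (fun x => cayley (M x) i j) U :=
  contDiffOn_matrix_mul (fun a b => contDiffOn_const.sub (hM a b))
    (contDiffOn_matrix_inv (fun a b => contDiffOn_const.add (hM a b)) h0) i j

section CommRing

variable [CommRing R] {A B S : Matrix ι ι R}

theorem cayley_eq_inv_mul (S : Matrix ι ι R) : cayley S = (1 + S)⁻¹ * (1 - S) := by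
  have h : Commute (1 - S) (1 + S) :=
    ((Commute.one_left _).sub_left ((Commute.one_right S).add_right (Commute.refl S)))
  rw [cayley]
  simpa only [Matrix.zpow_neg_one] using (Matrix.Commute.zpow_right h (-1)).eq

theorem cayley_transpose (S : Matrix ι ι R) : cayley S.transpose = (cayley S).transpose := by
  rw [cayley_eq_inv_mul S, cayley, Matrix.transpose_mul, Matrix.transpose_nonsing_inv,
    Matrix.transpose_add, Matrix.transpose_sub, Matrix.transpose_one]

theorem cayley_neg_mul_cayley (h : IsUnit (1 + S).det) (h' : IsUnit (1 - S).det) :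
    cayley (-S) * cayley S = 1 := by
  rw [cayley, cayley, sub_neg_eq_add, ← sub_eq_add_neg, mul_assoc,
    Matrix.nonsing_inv_mul_cancel_left _ _ h', Matrix.mul_nonsing_inv _ h]

theorem cayley_eq_neg_cayley_of_mul_eq_one (h : A * B = 1) : cayley A = -cayley B := by
  have hA : IsUnit A.det := Matrix.isUnit_det_of_right_inverse h
  have h_add : 1 + A = A * (1 + B) := by rw [mul_add, mul_one, h, add_comm]
  have h_sub : 1 - A = -(A * (1 - B)) := by rw [mul_sub, mul_one, h, neg_sub]
  rw [cayley_eq_inv_mul, cayley_eq_inv_mul, h_add, h_sub, Matrix.mul_inv_rev, mul_neg, mul_assoc,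
    Matrix.nonsing_inv_mul_cancel_left _ _ hA]

theorem one_add_cayley (hB : IsUnit (1 + B).det) : 1 + cayley B = (2 : R) • (1 + B)⁻¹ :=
  calc 1 + cayley B = (1 + B) * (1 + B)⁻¹ + (1 - B) * (1 + B)⁻¹ := by
        rw [Matrix.mul_nonsing_inv _ hB, cayley]
    _ = (2 : R) • (1 + B)⁻¹ := by
      rw [← add_mul, add_add_sub_cancel, add_mul, one_mul, two_smul]

theorem mul_one_add_cayley (hB : IsUnit (1 + B).det) : B * (1 + cayley B) = 1 - cayley B :=
  calc B * (1 + cayley B) = (1 + B) * (1 + B)⁻¹ - (1 - B) * (1 + B)⁻¹ := by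
        rw [one_add_cayley hB, ← sub_mul, add_sub_sub_cancel, ← two_smul R B, Matrix.smul_mul,
          Matrix.mul_smul]
    _ = 1 - cayley B := by rw [Matrix.mul_nonsing_inv _ hB, cayley]

theorem isUnit_det_one_add_cayley [Invertible (2 : R)] (hB : IsUnit (1 + B).det) :
    IsUnit (1 + cayley B).det := by
  rw [one_add_cayley hB, Matrix.det_smul]
  exact ((isUnit_of_invertible (2 : R)).pow _).mul (Matrix.isUnit_nonsing_inv_det _ hB)

theorem cayley_cayley [Invertible (2 : R)] (hB : IsUnit (1 + B).det) : cayley (cayley B) = B := by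
  rw [cayley, ← mul_one_add_cayley hB,
    Matrix.mul_nonsing_inv_cancel_right _ _ (isUnit_det_one_add_cayley hB)]

end CommRing

section Orthogonal

theorem transpose_cayley_of_mem_orthogonalGroup [CommRing R] {B : Matrix ι ι R}
    (hB : B ∈ Matrix.orthogonalGroup ι R) : (cayley B).transpose = -cayley B := by
  rw [← cayley_transpose]
  exact cayley_eq_neg_cayley_of_mul_eq_one ((Matrix.mem_orthogonalGroup_iff' _ _).1 hB)

variable [Field R] [LinearOrder R] [IsStrictOrderedRing R] {S : Matrix ι ι R}

theorem isUnit_det_one_add_of_transpose_eq_neg (hS : S.transpose = -S) :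
    IsUnit (1 + S).det := by
  refine isUnit_iff_ne_zero.2 fun h => ?_
  obtain ⟨v, hv, h0⟩ := Matrix.exists_mulVec_eq_zero_iff.2 h
  have h_skew : v ⬝ᵥ S.mulVec v = -(v ⬝ᵥ S.mulVec v) := by
    conv_lhs => rw [Matrix.dotProduct_mulVec, ← Matrix.mulVec_transpose, hS,
      Matrix.neg_mulVec, neg_dotProduct, dotProduct_comm]
  have h_quad : v ⬝ᵥ (1 + S).mulVec v = v ⬝ᵥ v := by
    rw [Matrix.add_mulVec, Matrix.one_mulVec, dotProduct_add, self_eq_neg.1 h_skew, add_zero]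
  rw [h0, dotProduct_zero] at h_quad
  exact hv (dotProduct_self_eq_zero.1 h_quad.symm)

theorem cayley_mem_orthogonalGroup (hS : S.transpose = -S) :
    cayley S ∈ Matrix.orthogonalGroup ι R := by
  have h_add := isUnit_det_one_add_of_transpose_eq_neg hS
  have h_sub : IsUnit (1 - S).det := by
    rw [← Matrix.det_transpose, Matrix.transpose_sub, hS, Matrix.transpose_one, sub_neg_eq_add]
    exact h_add
  refine (Matrix.mem_orthogonalGroup_iff' _ _).2 ?_
  change (cayley S).transpose * cayley S = 1
  rw [← cayley_transpose, hS, cayley_neg_mul_cayley h_add h_sub]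

end Orthogonal

end Cayley

/-! ### Coordinates on the skew-symmetric matrices -/

section Skew

variable {ι R : Type*} [LinearOrder ι]

theorem card_subtype_lt [Fintype ι] :
    Fintype.card {p : ι × ι // p.1 < p.2} = (Fintype.card ι).choose 2 := by
  have h_swap : Fintype.card {p : ι × ι // p.2 < p.1} = Fintype.card {p : ι × ι // p.1 < p.2} :=
    Fintype.card_congr ((Equiv.prodComm ι ι).subtypeEquiv fun _ => Iff.rfl)
  have h_ne : Fintype.card {p : ι × ι // p.1 ≠ p.2} =
      Fintype.card {p : ι × ι // p.1 < p.2} + Fintype.card {p : ι × ι // p.2 < p.1} := by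
    simp only [ne_iff_lt_or_gt]
    exact Fintype.card_subtype_or_disjoint _ _ (disjoint_iff_inf_le.2 fun p h => h.1.not_gt h.2)
  have h_offDiag : Fintype.card {p : ι × ι // p.1 ≠ p.2} =
      Fintype.card ι * (Fintype.card ι - 1) := by
    rw [Fintype.card_subtype, Nat.mul_sub_one, ← Finset.card_univ, ← Finset.offDiag_card]
    congr 1
    ext p
    simp
  rw [Nat.choose_two_right, ← h_offDiag, h_ne, h_swap, ← two_mul, Nat.mul_div_cancel_left _ two_pos]

/-- The skew-symmetric matrix with prescribed entries above the diagonal. -/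
def skewOfUpper [Ring R] (v : {p : ι × ι // p.1 < p.2} → R) : Matrix ι ι R :=
  Matrix.of fun i j =>
    if h : i < j then v ⟨(i, j), h⟩ else if h : j < i then -v ⟨(j, i), h⟩ else 0

/-- The entries of a matrix above the diagonal. -/
def upperEntries (S : Matrix ι ι R) (p : {p : ι × ι // p.1 < p.2}) : R := S p.1.1 p.1.2

theorem transpose_skewOfUpper [Ring R] (v : {p : ι × ι // p.1 < p.2} → R) :
    (skewOfUpper v).transpose = -skewOfUpper v := by
  ext i j
  rcases lt_trichotomy i j with h | h | h <;> simp [skewOfUpper, h, h.not_gt]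

theorem upperEntries_skewOfUpper [Ring R] (v : {p : ι × ι // p.1 < p.2} → R) :
    upperEntries (skewOfUpper v) = v := by
  ext p
  simp [upperEntries, skewOfUpper, p.2]

theorem skewOfUpper_upperEntries [Ring R] [IsAddTorsionFree R] {S : Matrix ι ι R}
    (hS : S.transpose = -S) : skewOfUpper (upperEntries S) = S := by
  have hS' : ∀ i j, S j i = -S i j := fun i j => congrFun (congrFun hS i) j
  ext i j
  rcases lt_trichotomy i j with h | h | h
  · simp [upperEntries, skewOfUpper, h]
  · subst h
    simp [skewOfUpper, self_eq_neg.1 (hS' i i)]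
  · simp [upperEntries, skewOfUpper, h, h.not_gt, hS' j i]

theorem contDiff_skewOfUpper_apply {𝕜 : Type*} [NontriviallyNormedField 𝕜] [Fintype ι]
    [NormedRing R] [NormedAlgebra 𝕜 R] {n : WithTop ℕ∞} (i j : ι) :
    ContDiff 𝕜 n fun v : {p : ι × ι // p.1 < p.2} → R => skewOfUpper v i j := by
  simp only [skewOfUpper, Matrix.of_apply]
  split_ifs <;> fun_prop

end Skew

/-! ### Cayley charts of the orthogonal group -/

section CayleyChart

variable {ι R : Type*} [LinearOrder ι] [Fintype ι]

/-- The chart of the orthogonal group around `A` which moves the Cayley chart around `1` by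
multiplication with `A`. -/
def cayleyChart [CommRing R] (A : Matrix ι ι R) (v : {p : ι × ι // p.1 < p.2} → R) :
    Matrix ι ι R :=
  A * cayley (skewOfUpper v)

/-- The coordinates of a matrix in the chart `cayleyChart A`. -/
def cayleyCoord [CommRing R] (A M : Matrix ι ι R) : {p : ι × ι // p.1 < p.2} → R :=
  upperEntries (cayley (A.transpose * M))

theorem transpose_mem_orthogonalGroup [CommRing R] {A : Matrix ι ι R}
    (hA : A ∈ Matrix.orthogonalGroup ι R) : A.transpose ∈ Matrix.orthogonalGroup ι R :=
  (Matrix.mem_orthogonalGroup_iff' _ _).2 (by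
    rw [Matrix.transpose_transpose, (Matrix.mem_orthogonalGroup_iff _ _).1 hA])

section Field

variable [Field R] [LinearOrder R] [IsStrictOrderedRing R] {A : Matrix ι ι R}

theorem cayleyCoord_cayleyChart (hA : A ∈ Matrix.orthogonalGroup ι R)
    (v : {p : ι × ι // p.1 < p.2} → R) : cayleyCoord A (cayleyChart A v) = v := by
  rw [cayleyCoord, cayleyChart, ← mul_assoc, (Matrix.mem_orthogonalGroup_iff' _ _).1 hA, one_mul,
    cayley_cayley (isUnit_det_one_add_of_transpose_eq_neg (transpose_skewOfUpper v)),
    upperEntries_skewOfUpper]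

theorem range_cayleyChart (hA : A ∈ Matrix.orthogonalGroup ι R) :
    Set.range (cayleyChart A) =
      {B | B ∈ Matrix.orthogonalGroup ι R ∧ IsUnit (1 + A.transpose * B).det} := by
  refine Set.Subset.antisymm ?_ ?_
  · rintro _ ⟨v, rfl⟩
    have hv := transpose_skewOfUpper v
    refine ⟨mul_mem hA (cayley_mem_orthogonalGroup hv), ?_⟩
    rw [cayleyChart, ← mul_assoc, (Matrix.mem_orthogonalGroup_iff' _ _).1 hA, one_mul]
    exact isUnit_det_one_add_cayley (isUnit_det_one_add_of_transpose_eq_neg hv)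
  · rintro B ⟨hB, hAB⟩
    have h_skew := transpose_cayley_of_mem_orthogonalGroup
      (mul_mem (transpose_mem_orthogonalGroup hA) hB)
    refine ⟨cayleyCoord A B, ?_⟩
    change A * cayley (skewOfUpper (upperEntries (cayley (A.transpose * B)))) = B
    rw [skewOfUpper_upperEntries h_skew, cayley_cayley hAB, ← mul_assoc,
      (Matrix.mem_orthogonalGroup_iff _ _).1 hA, one_mul]

end Field

variable {n : WithTop ℕ∞}

theorem contDiff_cayleyChart_apply (A : Matrix ι ι ℝ) (i j : ι) :
    ContDiff ℝ n fun v => cayleyChart A v i j := by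
  refine contDiffOn_univ.1 (contDiffOn_matrix_mul (M := fun _ => A)
    (fun _ _ => contDiffOn_const) (contDiffOn_cayley
      (fun a b => (contDiff_skewOfUpper_apply a b).contDiffOn) fun v _ => ?_) i j)
  exact (isUnit_det_one_add_of_transpose_eq_neg (transpose_skewOfUpper v)).ne_zero

theorem contDiffOn_cayleyCoord (A : Matrix ι ι ℝ) :
    ContDiffOn ℝ n (fun M : ι → ι → ℝ => cayleyCoord A (Matrix.of M))
      {M | (1 + A.transpose * Matrix.of M).det ≠ 0} := by
  have h_mul (i j : ι) : ContDiffOn ℝ n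
      (fun M : ι → ι → ℝ => (A.transpose * Matrix.of M) i j) Set.univ :=
    contDiffOn_matrix_mul (M := fun _ => A.transpose) (fun _ _ => contDiffOn_const)
      (fun i j => (contDiff_apply_apply ℝ ℝ i j).contDiffOn) i j
  exact contDiffOn_pi.2 fun p => contDiffOn_cayley
    (fun i j => (h_mul i j).mono (Set.subset_univ _)) (fun _ hM => hM) p.1.1 p.1.2

end CayleyChart

/-! ### Submanifolds -/

section Submanifold

variable {M N F G : Type} [NormedAddCommGroup F] [NormedSpace ℝ F] [NormedAddCommGroup G]
  [NormedSpace ℝ G] {d : ℕ}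

theorem isSmoothMap_of_contDiff {e : M → F} {e' : N → G} {f : M → N} {g : F → G}
    (hg : ContDiff ℝ ∞ g) (h : ∀ x, e' (f x) = g (e x)) : IsSmoothMap e e' f :=
  fun _ => ⟨Set.univ, isOpen_univ, trivial, g, hg.contDiffOn, fun y _ => h y⟩

variable [TopologicalSpace M] [TopologicalSpace N]

theorem isSmoothSubmanifold_of_charts {V : Type*} [NormedAddCommGroup V] [NormedSpace ℝ V]
    [FiniteDimensional ℝ V] (hd : Module.finrank ℝ V = d) {e : M → F} (he : IsEmbedding e)
    (h : ∀ x : M, ∃ U : Set F, IsOpen U ∧ e x ∈ U ∧ ∃ W : Set V, IsOpen W ∧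
      ∃ (ψ : V → F) (φ : F → V), ContDiffOn ℝ ∞ ψ W ∧ ContDiffOn ℝ ∞ φ U ∧
        ψ '' W = Set.range e ∩ U ∧ ∀ v ∈ W, φ (ψ v) = v) :
    IsSmoothSubmanifold d e := by
  let L : E d ≃L[ℝ] V := ContinuousLinearEquiv.ofFinrankEq (by simp [hd])
  refine ⟨he, fun x => ?_⟩
  obtain ⟨U, hU, hxU, W, hW, ψ, φ, hψ, hφ, h_image, h_inv⟩ := h x
  refine ⟨U, hU, hxU, L ⁻¹' W, hW.preimage L.continuous, ψ ∘ L, L.symm ∘ φ,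
    hψ.comp L.contDiff.contDiffOn fun _ hv => hv, L.symm.contDiff.comp_contDiffOn hφ, ?_,
    fun v hv => ?_⟩
  · rw [Set.image_comp, Set.image_preimage_eq _ L.surjective, h_image]
  · change L.symm (φ (ψ (L v))) = v
    rw [h_inv _ hv, L.symm_apply_apply]

theorem IsSmoothSubmanifold.of_range_eq_inter {e : M → F} (he : IsSmoothSubmanifold d e)
    {e' : N → F} (he' : IsEmbedding e') {W : Set F} (hW : IsOpen W)
    (h_range : Set.range e' = Set.range e ∩ W) : IsSmoothSubmanifold d e' := by
  refine ⟨he', fun y => ?_⟩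
  obtain ⟨⟨x, hx⟩, hyW⟩ : e' y ∈ Set.range e ∩ W := h_range ▸ Set.mem_range_self y
  obtain ⟨U, hU, hxU, V, hV, ψ, φ, hψ, hφ, h_image, h_inv⟩ := he.2 x
  refine ⟨U ∩ W, hU.inter hW, ⟨hx ▸ hxU, hyW⟩, V ∩ ψ ⁻¹' W,
    hψ.continuousOn.isOpen_inter_preimage hV hW, ψ, φ, hψ.mono Set.inter_subset_left,
    hφ.mono Set.inter_subset_left, ?_, fun v hv => h_inv v hv.1⟩
  rw [Set.image_inter_preimage, h_image, h_range]
  ext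
  simp only [Set.mem_inter_iff]
  tauto

theorem IsSmoothSubmanifold.of_homeomorph {e : N → G} (he : IsSmoothSubmanifold d e) (f : M ≃ₜ N)
    {e' : M → F} {L : G → F} {K : F → G} (hL : ContDiff ℝ ∞ L) (hK : ContDiff ℝ ∞ K)
    (hLe : ∀ x, e' x = L (e (f x))) (hKe : ∀ x, K (e' x) = e (f x)) :
    IsSmoothSubmanifold d e' := by
  have h_emb : IsEmbedding (K ∘ e') := (funext hKe : K ∘ e' = e ∘ f) ▸ he.1.comp f.isEmbedding
  have h_cont : Continuous e' := (funext hLe : e' = L ∘ e ∘ f) ▸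
    hL.continuous.comp (he.1.continuous.comp f.continuous)
  refine ⟨.of_comp h_cont hK.continuous h_emb, fun x => ?_⟩
  obtain ⟨U, hU, hxU, V, hV, ψ, φ, hψ, hφ, h_image, h_inv⟩ := he.2 (f x)
  have hKL : Set.EqOn (K ∘ L) id (Set.range e) := by
    rintro _ ⟨y, rfl⟩
    obtain ⟨x, rfl⟩ := f.surjective y
    rw [Function.comp_apply, ← hLe, hKe, id]
  have h_range : Set.range e' = L '' Set.range e := by
    rw [← Set.range_comp, ← f.surjective.range_comp]
    exact congrArg Set.range (funext hLe)
  have hψ_range : ∀ v ∈ V, ψ v ∈ Set.range e := fun v hv =>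
    (h_image.subset (Set.mem_image_of_mem ψ hv)).1
  refine ⟨K ⁻¹' U, hU.preimage hK.continuous, by rwa [Set.mem_preimage, hKe], V, hV, L ∘ ψ, φ ∘ K,
    hL.comp_contDiffOn hψ, hφ.comp hK.contDiffOn fun _ hx => hx, ?_, fun v hv => ?_⟩
  · rw [Set.image_comp, h_image, h_range, ← Set.image_inter_preimage, ← Set.preimage_comp,
      hKL.inter_preimage_eq, Set.preimage_id]
  · change φ ((K ∘ L) (ψ v)) = v
    rw [hKL (hψ_range v hv), id, h_inv v hv]

theorem isEmbedding_entries {k : ℕ} (T : Set (Matrix (Fin k) (Fin k) ℝ)) :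
    IsEmbedding (entries : T → Fin k → Fin k → ℝ) :=
  IsEmbedding.subtypeVal

theorem isSmoothSubmanifold_O (k : ℕ) :
    IsSmoothSubmanifold (k * (k - 1) / 2) (entries : O k → Fin k → Fin k → ℝ) := by
  have h_finrank : Module.finrank ℝ ({p : Fin k × Fin k // p.1 < p.2} → ℝ) = k * (k - 1) / 2 := by
    rw [Module.finrank_fintype_fun_eq_card, card_subtype_lt, Fintype.card_fin, Nat.choose_two_right]
  refine isSmoothSubmanifold_of_charts h_finrank (isEmbedding_entries _) fun ⟨A, hA⟩ => ?_
  have h_open : IsOpen {M : Fin k → Fin k → ℝ | (1 + A.transpose * Matrix.of M).det ≠ 0} :=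
    isOpen_ne_fun (by fun_prop) continuous_const
  refine ⟨_, h_open, ?_, Set.univ, isOpen_univ, fun v => Matrix.of.symm (cayleyChart A v),
    fun M => cayleyCoord A (Matrix.of M),
    contDiffOn_pi.2 fun i => contDiffOn_pi.2 fun j => (contDiff_cayleyChart_apply A i j).contDiffOn,
    contDiffOn_cayleyCoord A, ?_, fun v _ => cayleyCoord_cayleyChart hA v⟩
  · change (1 + A.transpose * A).det ≠ 0
    rw [(Matrix.mem_orthogonalGroup_iff' _ _).1 hA, ← two_smul ℝ (1 : Matrix _ _ ℝ),
      Matrix.det_smul, Matrix.det_one, mul_one]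
    exact pow_ne_zero _ two_ne_zero
  · refine Set.image_univ.trans (Set.ext fun M => ?_)
    have h_entries : M ∈ O k ↔ M ∈ Set.range (entries : O k → _) :=
      ⟨fun hM => ⟨⟨M, hM⟩, rfl⟩, by rintro ⟨B, rfl⟩; exact B.2⟩
    exact (Set.ext_iff.1 (range_cayleyChart hA) M).trans (and_congr h_entries isUnit_iff_ne_zero)

theorem isSmoothSubmanifold_entries {k : ℕ} {W : Set (Matrix (Fin k) (Fin k) ℝ)} (hW : IsOpen W) :
    IsSmoothSubmanifold (k * (k - 1) / 2) (entries : ↥(O k ∩ W) → Fin k → Fin k → ℝ) := by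
  refine (isSmoothSubmanifold_O k).of_range_eq_inter (isEmbedding_entries _) hW ?_
  change Set.range Subtype.val = Set.range Subtype.val ∩ W
  rw [Subtype.range_coe, Subtype.range_coe]

end Submanifold

/-! ### Images of a configuration under similarities -/

section OrthogonalAction

variable {k : ℕ} {U : Matrix (Fin k) (Fin k) ℝ}

theorem inner_toEuclideanLin_of_mem_O (hU : U ∈ O k) (v w : E k) :
    inner ℝ (U.toEuclideanLin v) (U.toEuclideanLin w) = inner ℝ v w := by
  have h_mul : U.transpose * U = 1 := (Matrix.mem_orthogonalGroup_iff' _ _).1 hU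
  rw [← LinearMap.adjoint_inner_right, ← Matrix.toEuclideanLin_conjTranspose_eq_adjoint,
    Matrix.conjTranspose_eq_transpose_of_trivial, Matrix.toLpLin_apply, Matrix.toLpLin_apply,
    Matrix.mulVec_mulVec, h_mul, Matrix.one_mulVec]

theorem norm_toEuclideanLin_of_mem_O (hU : U ∈ O k) (v : E k) : ‖U.toEuclideanLin v‖ = ‖v‖ := by
  rw [norm_eq_sqrt_real_inner, inner_toEuclideanLin_of_mem_O hU, ← norm_eq_sqrt_real_inner]

theorem continuous_toEuclideanLin_apply (v : E k) :
    Continuous fun U : Matrix (Fin k) (Fin k) ℝ => U.toEuclideanLin v :=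
  (PiLp.continuous_toLp 2 _).comp (continuous_id.matrix_mulVec continuous_const)

end OrthogonalAction

section SimilarImage

variable {n k : ℕ}

/-- The image of the configuration `q` under the similarity `v ↦ a + s U v`. For `s = 0` it is the
limit, as `s → 0⁺`, of these images in the compactified configuration space: all points collide
at `a` and only the directions and ratios remember `U` and `q`. -/
def similarImage (q : Conf n k) (U : O k) (a : E k) (s : ℝ) : Amb n k :=
  (fun i => a + s • U.1.toEuclideanLin (q.1 i),
    fun t => ⟨U.1.toEuclideanLin (dir q t), by
      rw [mem_sphere_zero_iff_norm, norm_toEuclideanLin_of_mem_O U.2, norm_eq_of_mem_sphere]⟩,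
    ratio q)

theorem continuous_similarImage (q : Conf n k) :
    Continuous fun p : O k × E k × ℝ => similarImage q p.1 p.2.1 p.2.2 := by
  have h_act (v : E k) : Continuous fun p : O k × E k × ℝ => p.1.1.toEuclideanLin v :=
    (continuous_toEuclideanLin_apply v).comp (continuous_subtype_val.comp continuous_fst)
  exact .prodMk (continuous_pi fun i => continuous_snd.fst.add (continuous_snd.snd.smul (h_act _)))
    (.prodMk (continuous_pi fun t => (h_act _).subtype_mk _) continuous_const)

theorem similarImage_mem_range_alpha (q : Conf n k) (U : O k) (a : E k) {s : ℝ} (hs : 0 < s) :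
    similarImage q U a s ∈ Set.range alpha := by
  have h_sub (i j) : (a + s • U.1.toEuclideanLin (q.1 i)) - (a + s • U.1.toEuclideanLin (q.1 j)) =
      s • U.1.toEuclideanLin (q.1 i - q.1 j) := by
    rw [add_sub_add_left_eq_sub, ← smul_sub, ← map_sub]
  have h_norm (i j) : ‖s • U.1.toEuclideanLin (q.1 i - q.1 j)‖ = s * ‖q.1 i - q.1 j‖ := by
    rw [norm_smul, norm_toEuclideanLin_of_mem_O U.2, Real.norm_of_nonneg hs.le]
  refine ⟨⟨pos (similarImage q U a s), fun i j hij => q.2 ?_⟩, ?_⟩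
  · rw [← sub_eq_zero, ← norm_eq_zero, ← mul_right_inj' hs.ne', ← h_norm, ← h_sub, mul_zero,
      norm_eq_zero]
    exact sub_eq_zero.2 hij
  · refine Prod.ext rfl (Prod.ext (funext fun t => Subtype.ext ?_) (funext fun t => ?_))
    · simp only [alpha, dir, similarImage, pos]
      rw [h_sub, h_norm, map_smul, smul_smul, mul_inv_rev, inv_mul_cancel_right₀ hs.ne']
    · simp only [alpha, ratio, similarImage, pos]
      rw [h_sub, h_sub, h_norm, h_norm, mul_div_mul_left _ _ hs.ne']

theorem eq_alpha_of_mem_range {x : Amb n k} (hx : x ∈ Set.range alpha) {p : Conf n k}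
    (h : pos x = p.1) : x = alpha p := by
  obtain ⟨p', rfl⟩ := hx
  exact congrArg alpha (Subtype.ext h)

variable {Δ q : Conf (k + 1) k}

theorem Pi_similarImage (q : Conf (k + 1) k) (U : O k) (a : E k) (s : ℝ) :
    Pi (similarImage q U a s) = U.1 * Pi (alpha q) := by
  ext i j
  simp [Pi, similarImage, alpha, Matrix.toLpLin_apply, Matrix.mul_apply, Matrix.mulVec, dotProduct]

theorem pose_similarImage (Δ q : Conf (k + 1) k) (U : O k) (a : E k) (s : ℝ) :
    pose Δ (similarImage q U a s) = U.1 * pose Δ (alpha q) := by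
  rw [pose, Pi_similarImage, pose, Matrix.mul_assoc]

theorem similarImage_mem_sim (hq : q ∈ simOpen Δ) (U : O k) (a : E k) {s : ℝ} (hs : 0 ≤ s) :
    similarImage q U a s ∈ sim Δ := by
  have h_cont : Continuous fun s => similarImage q U a s :=
    (continuous_similarImage q).comp (by fun_prop : Continuous fun s : ℝ => (U, a, s))
  refine map_mem_closure h_cont (s := Set.Ioi 0) (by rwa [closure_Ioi]) fun r hr => ?_
  obtain ⟨p, hp⟩ := similarImage_mem_range_alpha q U a hr
  exact ⟨p, fun t => (congrFun (congrArg (·.2.2) hp) t).trans (hq t), hp⟩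

end SimilarImage

/-! ### Normal forms of simplices -/

section NormalForm

variable {k : ℕ} {Δ q : Conf (k + 1) k}

/-- `q` is the normal form of `Δ`: the simplex similar to `Δ` that is inscribed in the unit sphere
and has the identity as its pose. -/
structure IsNormalForm (Δ q : Conf (k + 1) k) : Prop where
  similar : q ∈ simOpen Δ
  norm_eq_one : ∀ i, ‖q.1 i‖ = 1
  pose_eq_one : pose Δ (alpha q) = 1

theorem exists_isNormalForm (hk : 1 ≤ k) (hΔ : AffineIndependent ℝ Δ.1) :
    ∃ q, IsNormalForm Δ q := by
  obtain ⟨m, rfl⟩ := Nat.exists_eq_add_of_le' hk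
  let S : Affine.Simplex ℝ (E (m + 1)) (m + 1) := ⟨Δ.1, hΔ⟩
  have h_radius : 0 < S.circumradius := S.circumradius_pos
  have h_pose : pose Δ (alpha Δ) ∈ O (m + 1) :=
    mapsTo_pose Δ hΔ (subset_closure ⟨Δ, fun _ => rfl, rfl⟩)
  let U : O (m + 1) := ⟨_, transpose_mem_orthogonalGroup h_pose⟩
  obtain ⟨q, hq⟩ := similarImage_mem_range_alpha Δ U
    (-(S.circumradius⁻¹ • U.1.toEuclideanLin S.circumcenter)) (inv_pos.2 h_radius)
  refine ⟨q, congrFun (congrArg (·.2.2) hq), fun i => ?_, ?_⟩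
  · have h_pos : q.1 i = S.circumradius⁻¹ • U.1.toEuclideanLin (S.points i - S.circumcenter) := by
      rw [map_sub, smul_sub, sub_eq_neg_add]
      exact congrFun (congrArg Prod.fst hq) i
    rw [h_pos, norm_smul, norm_toEuclideanLin_of_mem_O U.2, ← dist_eq_norm,
      S.dist_circumcenter_eq_circumradius, norm_inv, Real.norm_of_nonneg h_radius.le,
      inv_mul_cancel₀ h_radius.ne']
  · rw [hq, pose_similarImage]
    exact (Matrix.mem_orthogonalGroup_iff' _ _).1 h_pose

theorem alpha_mem_compactConf {n : ℕ} {M : Set (E k)} {p : Conf n k} (hp : ∀ i, p.1 i ∈ M) :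
    alpha p ∈ compactConf n M :=
  ⟨subset_closure ⟨p, hp, rfl⟩, hp⟩

namespace IsNormalForm

theorem alpha_mem_sphereConf (hq : IsNormalForm Δ q) : alpha q ∈ sphereConf k :=
  alpha_mem_compactConf fun i => mem_sphere_zero_iff_norm.2 (hq.norm_eq_one i)

theorem pose_similarImage (hq : IsNormalForm Δ q) (U : O k) (a : E k) (s : ℝ) :
    pose Δ (similarImage q U a s) = U.1 := by
  rw [InscribedSimplex.pose_similarImage, hq.pose_eq_one, Matrix.mul_one]

theorem Pi_alpha_eq (hq : IsNormalForm Δ q) (hΔ : AffineIndependent ℝ Δ.1) :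
    Pi (alpha q) = P Δ := by
  rw [← pose_mul_P Δ hΔ, hq.pose_eq_one, Matrix.one_mul]

end IsNormalForm

end NormalForm

section Recovery

variable {k : ℕ} {Δ q : Conf (k + 1) k}

theorem norm_sub_mul_norm_sub_of_ratio_eq {n : ℕ} {p q : Conf n k} (h : ∀ t, ratio p t = ratio q t)
    (i j l : Fin n) :
    ‖p.1 i - p.1 j‖ * ‖q.1 i - q.1 l‖ = ‖p.1 i - p.1 l‖ * ‖q.1 i - q.1 j‖ := by
  rcases eq_or_ne i j with rfl | hij
  · simp
  rcases eq_or_ne i l with rfl | hil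
  · simp
  rcases eq_or_ne j l with rfl | hjl
  · rfl
  have h_ratio := congrArg ENNReal.toReal (h ⟨(i, j, l), hij, hjl, hil⟩)
  have h_ne {r : Conf n k} : ‖r.1 i - r.1 l‖ ≠ 0 := norm_ne_zero_iff.2 (sub_ne_zero.2 (r.2.ne hil))
  rw [ratio_toReal, ratio_toReal, div_eq_div_iff h_ne h_ne] at h_ratio
  linarith

/-- The number `s` such that `x` is the image of `q` under a similarity `v ↦ a + s U v`, read off
the edge joining the first and the last vertex. -/
def scale (q : Conf (k + 1) k) (x : Amb (k + 1) k) : ℝ :=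
  ‖pos x 0 - pos x (Fin.last k)‖ / ‖q.1 0 - q.1 (Fin.last k)‖

/-- The vector `a` such that `x` is the image of the normal form `q` of `Δ` under the similarity
`v ↦ a + s U v` with `U` the pose of `x`, read off the first vertex. If the vertices of `x` are
distinct it is the center of the sphere through them. -/
def center (Δ q : Conf (k + 1) k) (x : Amb (k + 1) k) : E k :=
  pos x 0 - scale q x • (pose Δ x).toEuclideanLin (q.1 0)

theorem scale_nonneg (q : Conf (k + 1) k) (x : Amb (k + 1) k) : 0 ≤ scale q x := by
  unfold scale
  positivity

theorem continuous_scale (q : Conf (k + 1) k) : Continuous (scale q) := by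
  unfold scale pos
  fun_prop

theorem continuous_center (Δ q : Conf (k + 1) k) : Continuous (center Δ q) := by
  have h_pos : Continuous fun x : Amb (k + 1) k => pos x 0 := by
    unfold pos
    fun_prop
  exact h_pos.sub ((continuous_scale q).smul
    ((continuous_toEuclideanLin_apply (q.1 0)).comp (continuous_pose Δ)))

theorem Pi_col_eq_toEuclideanLin {U : Matrix (Fin k) (Fin k) ℝ} {x y : Amb (k + 1) k}
    (h : Pi x = U * Pi y) (j : Fin k) :
    (x.2.1 ⟨(j.succ, 0), Fin.succ_ne_zero j⟩ : E k) =
      U.toEuclideanLin (y.2.1 ⟨(j.succ, 0), Fin.succ_ne_zero j⟩ : E k) := by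
  ext i
  exact congrFun (congrFun h i) j

theorem norm_smul_dir {n : ℕ} (p : Conf n k) (t : Pairs n) :
    ‖p.1 t.1.1 - p.1 t.1.2‖ • (dir p t : E k) = p.1 t.1.1 - p.1 t.1.2 :=
  smul_inv_smul₀ (norm_ne_zero_iff.2 (sub_ne_zero.2 (p.2.ne t.2))) _

namespace IsNormalForm

theorem alpha_eq_similarImage (hq : IsNormalForm Δ q) (hk : 1 ≤ k) (hΔ : AffineIndependent ℝ Δ.1)
    {p : Conf (k + 1) k} (hp : p ∈ simOpen Δ) (hU : pose Δ (alpha p) ∈ O k) :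
    alpha p = similarImage q ⟨_, hU⟩ (center Δ q (alpha p)) (scale q (alpha p)) := by
  have h_last : (0 : Fin (k + 1)) ≠ Fin.last k := by
    rw [Ne, Fin.ext_iff, Fin.val_last, Fin.val_zero]
    lia
  have h_edge {r : Conf (k + 1) k} : 0 < ‖r.1 0 - r.1 (Fin.last k)‖ :=
    norm_pos_iff.2 (sub_ne_zero.2 (r.2.ne h_last))
  have h_norm (i) : ‖p.1 i - p.1 0‖ = scale q (alpha p) * ‖q.1 i - q.1 0‖ := by
    have h := norm_sub_mul_norm_sub_of_ratio_eq (fun t => (hp t).trans (hq.similar t).symm) 0 i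
      (Fin.last k)
    rw [scale, div_mul_eq_mul_div, eq_div_iff h_edge.ne', norm_sub_rev (p.1 i),
      norm_sub_rev (q.1 i)]
    exact h
  have h_Pi : Pi (alpha p) = pose Δ (alpha p) * Pi (alpha q) := by
    rw [hq.Pi_alpha_eq hΔ, pose_mul_P Δ hΔ]
  have h_diff (j : Fin k) : p.1 j.succ - p.1 0 =
      scale q (alpha p) • (pose Δ (alpha p)).toEuclideanLin (q.1 j.succ - q.1 0) := by
    rw [← norm_smul_dir p ⟨(j.succ, 0), Fin.succ_ne_zero j⟩,
      ← norm_smul_dir q ⟨(j.succ, 0), Fin.succ_ne_zero j⟩, map_smul, smul_smul, ← h_norm]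
    exact congrArg _ (Pi_col_eq_toEuclideanLin h_Pi j)
  have h_scale : 0 < scale q (alpha p) := div_pos h_edge h_edge
  refine (eq_alpha_of_mem_range (similarImage_mem_range_alpha q _ _ h_scale)
    (funext fun i => ?_)).symm
  change p.1 0 - _ + _ = p.1 i
  rw [sub_add_eq_add_sub, add_sub_assoc, ← smul_sub, ← map_sub, ← eq_sub_iff_add_eq']
  exact Fin.cases (by simp) (fun j => (h_diff j).symm) i

theorem eq_similarImage_of_mem_sim (hq : IsNormalForm Δ q) (hk : 1 ≤ k)
    (hΔ : AffineIndependent ℝ Δ.1) {x : Amb (k + 1) k} (hx : x ∈ sim Δ) :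
    x = similarImage q ⟨pose Δ x, mapsTo_pose Δ hΔ hx⟩ (center Δ q x) (scale q x) := by
  have h_dense : Dense ((↑) ⁻¹' (alpha '' simOpen Δ) : Set (sim Δ)) := by
    have h_subset : alpha '' simOpen Δ ⊆ sim Δ := subset_closure
    rw [Subtype.dense_iff, Subtype.image_preimage_coe, Set.inter_eq_right.2 h_subset]
    exact subset_rfl
  have h_cont : Continuous fun x : sim Δ =>
      similarImage q (poseMap Δ (mapsTo_pose Δ hΔ) x) (center Δ q x) (scale q x) :=
    (continuous_similarImage q).comp ((poseMap Δ (mapsTo_pose Δ hΔ)).continuous.prodMk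
      (((continuous_center Δ q).comp continuous_subtype_val).prodMk
        ((continuous_scale q).comp continuous_subtype_val)))
  refine congrFun (continuous_subtype_val.ext_on h_dense h_cont ?_) ⟨x, hx⟩
  rintro ⟨_, hx⟩ ⟨p, hp, rfl⟩
  exact hq.alpha_eq_similarImage hk hΔ hp _

end IsNormalForm

end Recovery

/-! ### Inscribed simplices -/

section Inscribed

variable {k : ℕ} {Δ q : Conf (k + 1) k}

/- For distinct points this says that a chord of the sphere is orthogonal to the vector from the
center to its midpoint; directions of collided points are limits of directions of chords. -/
theorem inner_dir_pos_add_eq_zero {n : ℕ} {x : Amb n k}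
    (hx : x ∈ compactConf n (Metric.sphere (0 : E k) 1)) (t : Pairs n) :
    inner ℝ (x.2.1 t : E k) (pos x t.1.1 + pos x t.1.2) = 0 := by
  have h_closed :
      IsClosed {x : Amb n k | inner ℝ (x.2.1 t : E k) (pos x t.1.1 + pos x t.1.2) = 0} := by
    refine isClosed_eq ?_ continuous_const
    unfold pos
    fun_prop
  refine closure_minimal ?_ h_closed hx.1
  rintro _ ⟨p, hp, rfl⟩
  have h_norm : ‖p.1 t.1.1‖ = ‖p.1 t.1.2‖ := by
    rw [mem_sphere_zero_iff_norm.1 (hp _), mem_sphere_zero_iff_norm.1 (hp _)]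
  change inner ℝ (‖p.1 t.1.1 - p.1 t.1.2‖⁻¹ • (p.1 t.1.1 - p.1 t.1.2))
    (p.1 t.1.1 + p.1 t.1.2) = 0
  rw [real_inner_smul_left, real_inner_comm, (real_inner_add_sub_eq_zero_iff _ _).2 h_norm,
    mul_zero]

theorem eq_zero_of_inner_dir_eq_zero {x : Amb (k + 1) k} (hx : IsUnit (Pi x).det) {v : E k}
    (h : ∀ j : Fin k, inner ℝ (x.2.1 ⟨(j.succ, 0), Fin.succ_ne_zero j⟩ : E k) v = 0) : v = 0 := by
  have h_mulVec : (Pi x).transpose.mulVec v = 0 := funext fun j => by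
    rw [Pi.zero_apply, ← h j, PiLp.inner_apply]
    simp [Matrix.mulVec, dotProduct, InscribedSimplex.Pi, mul_comm]
  have h_inj := Matrix.mulVec_injective_of_isUnit
    ((Matrix.isUnit_iff_isUnit_det (Pi x).transpose).2 (by rwa [Matrix.det_transpose]))
  exact PiLp.ext (congrFun (h_inj (h_mulVec.trans (Matrix.mulVec_zero _).symm)))

namespace IsNormalForm

theorem similarImage_mem_sphereConf (hq : IsNormalForm Δ q) (U : O k) :
    similarImage q U 0 1 ∈ sphereConf k := by
  have h_sphere (i) : pos (similarImage q U 0 1) i ∈ Metric.sphere (0 : E k) 1 := by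
    change 0 + (1 : ℝ) • U.1.toEuclideanLin (q.1 i) ∈ _
    rw [zero_add, one_smul, mem_sphere_zero_iff_norm, norm_toEuclideanLin_of_mem_O U.2,
      hq.norm_eq_one]
  obtain ⟨p, hp⟩ := similarImage_mem_range_alpha q U 0 one_pos
  rw [← hp] at h_sphere ⊢
  exact alpha_mem_compactConf h_sphere

theorem eq_zero_and_eq_one_of_similarImage_mem_sphereConf (hq : IsNormalForm Δ q)
    (hΔ : AffineIndependent ℝ Δ.1) {U : O k} {a : E k} {s : ℝ} (hs : 0 ≤ s)
    (h : similarImage q U a s ∈ sphereConf k) : a = 0 ∧ s = 1 := by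
  have h_det : IsUnit (Pi (similarImage q U a s)).det := by
    rw [Pi_similarImage, hq.Pi_alpha_eq hΔ, Matrix.det_mul]
    exact (Matrix.UnitaryGroup.det_isUnit U).mul (isUnit_det_P Δ hΔ)
  have ha : a = 0 := eq_zero_of_inner_dir_eq_zero h_det fun j => by
    have h_image := inner_dir_pos_add_eq_zero h ⟨(j.succ, 0), Fin.succ_ne_zero j⟩
    have h_normal := inner_dir_pos_add_eq_zero hq.alpha_mem_sphereConf
      ⟨(j.succ, 0), Fin.succ_ne_zero j⟩
    simp only [pos, similarImage, alpha] at h_image h_normal ⊢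
    rw [add_add_add_comm, ← smul_add, ← map_add, inner_add_right, inner_add_right,
      real_inner_smul_right, inner_toEuclideanLin_of_mem_O U.2, h_normal] at h_image
    linarith
  have h_norm : ‖pos (similarImage q U a s) 0‖ = s := by
    change ‖a + s • U.1.toEuclideanLin (q.1 0)‖ = s
    rw [ha, zero_add, norm_smul, norm_toEuclideanLin_of_mem_O U.2, hq.norm_eq_one, mul_one,
      Real.norm_of_nonneg hs]
  exact ⟨ha, h_norm.symm.trans (mem_sphere_zero_iff_norm.1 (h.2 0))⟩

theorem eq_similarImage_of_mem_sphereConf (hq : IsNormalForm Δ q) (hk : 1 ≤ k)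
    (hΔ : AffineIndependent ℝ Δ.1) {x : Amb (k + 1) k} (hx : x ∈ sim Δ) (hs : x ∈ sphereConf k) :
    x = similarImage q ⟨pose Δ x, mapsTo_pose Δ hΔ hx⟩ 0 1 := by
  have hx_eq := hq.eq_similarImage_of_mem_sim hk hΔ hx
  obtain ⟨h_center, h_scale⟩ := hq.eq_zero_and_eq_one_of_similarImage_mem_sphereConf hΔ
    (scale_nonneg q x) (hx_eq ▸ hs)
  rwa [h_center, h_scale] at hx_eq

end IsNormalForm

end Inscribed

/-! ### The pose map -/

section PoseMap

variable {k : ℕ} {Δ q : Conf (k + 1) k} {T : Set (Matrix (Fin k) (Fin k) ℝ)}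

/-- The part of `Sim(Δ)` consisting of the points with pose in `T`. It is `Sim(Δ)`, `Sim⁺(Δ)` or
`Sim⁻(Δ)` for `T` equal to `O(k)`, `SO(k)` or `O(k) \ SO(k)`. -/
def simWithPose (Δ : Conf (k + 1) k) (T : Set (Matrix (Fin k) (Fin k) ℝ)) : Set (Amb (k + 1) k) :=
  {x | x ∈ sim Δ ∧ pose Δ x ∈ T}

theorem mapsTo_pose_simWithPose (Δ : Conf (k + 1) k) (T : Set (Matrix (Fin k) (Fin k) ℝ)) :
    Set.MapsTo (pose Δ) (simWithPose Δ T) T :=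
  fun _ hx => hx.2

theorem simWithPose_O (hΔ : AffineIndependent ℝ Δ.1) : simWithPose Δ (O k) = sim Δ :=
  Set.inter_eq_left.2 (mapsTo_pose Δ hΔ)

theorem simWithPose_O_diff_SO (hΔ : AffineIndependent ℝ Δ.1) :
    simWithPose Δ (O k \ SO k) = simMinus Δ :=
  Set.ext fun _ => ⟨fun hx => ⟨hx.1, fun h => hx.2.2 h.2⟩,
    fun hx => ⟨hx.1, mapsTo_pose_minus Δ hΔ hx⟩⟩

/-- The positions of the vertices of the image of `q` under the matrix `M`, as a function on the
vector space of all matrices. -/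
def vertices (q : Conf (k + 1) k) (M : Fin k → Fin k → ℝ) : Fin (k + 1) → E k :=
  fun i => (Matrix.of M).toEuclideanLin (q.1 i)

theorem contDiff_vertices (q : Conf (k + 1) k) : ContDiff ℝ ∞ (vertices q) := by
  refine contDiff_pi.2 fun i => contDiff_piLp' 2 fun a => ?_
  simp only [vertices, Matrix.toLpLin_apply, Matrix.mulVec, dotProduct, Matrix.of_apply]
  fun_prop

/-- The pose of a simplex congruent to `q` in terms of its vertices, extended to all tuples of
points. The lengths of the edges are those of `q`, which makes this function linear. -/
def poseOfVertices (Δ q : Conf (k + 1) k) (p : Fin (k + 1) → E k) : Fin k → Fin k → ℝ :=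
  Matrix.of.symm (Matrix.of (fun i j => ‖q.1 j.succ - q.1 0‖⁻¹ * (p j.succ i - p 0 i)) * (P Δ)⁻¹)

theorem contDiff_poseOfVertices (Δ q : Conf (k + 1) k) : ContDiff ℝ ∞ (poseOfVertices Δ q) := by
  refine contDiff_pi.2 fun a => contDiff_pi.2 fun b => ?_
  simp only [poseOfVertices, Matrix.of_symm_apply, Matrix.mul_apply, Matrix.of_apply]
  fun_prop

theorem poseOfVertices_similarImage (Δ q : Conf (k + 1) k) (U : O k) (a : E k) :
    poseOfVertices Δ q (pos (similarImage q U a 1)) =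
      Matrix.of.symm (pose Δ (similarImage q U a 1)) := by
  refine congrArg Matrix.of.symm (congrArg (· * (P Δ)⁻¹) (Matrix.ext fun i j => ?_))
  have h_diff : pos (similarImage q U a 1) j.succ - pos (similarImage q U a 1) 0 =
      U.1.toEuclideanLin (q.1 j.succ - q.1 0) := by
    simp [pos, similarImage]
  change _ * (pos (similarImage q U a 1) j.succ - pos (similarImage q U a 1) 0) i =
    U.1.toEuclideanLin (‖q.1 j.succ - q.1 0‖⁻¹ • (q.1 j.succ - q.1 0)) i
  rw [h_diff, map_smul, PiLp.smul_apply, smul_eq_mul]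

namespace IsNormalForm

/-- The pose map as a homeomorphism from the inscribed simplices similar to `Δ` with pose in `T`
onto `T`. -/
def poseHomeomorph (hq : IsNormalForm Δ q) (hk : 1 ≤ k) (hΔ : AffineIndependent ℝ Δ.1)
    (hT : T ⊆ O k) : ↥(simWithPose Δ T ∩ sphereConf k) ≃ₜ T where
  toFun := poseMap Δ ((mapsTo_pose_simWithPose Δ T).mono_left Set.inter_subset_left)
  invFun A := ⟨similarImage q ⟨A, hT A.2⟩ 0 1, ⟨similarImage_mem_sim hq.similar _ _ zero_le_one,
    (hq.pose_similarImage _ _ _).symm ▸ A.2⟩, hq.similarImage_mem_sphereConf _⟩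
  left_inv x := Subtype.ext (hq.eq_similarImage_of_mem_sphereConf hk hΔ x.2.1.1 x.2.2).symm
  right_inv _ := Subtype.ext (hq.pose_similarImage _ _ _)
  continuous_invFun := ((continuous_similarImage q).comp (by fun_prop :
    Continuous fun A : T => ((⟨A, hT A.2⟩, 0, 1) : O k × E k × ℝ))).subtype_mk _

theorem positions_poseHomeomorph_symm (hq : IsNormalForm Δ q) (hk : 1 ≤ k)
    (hΔ : AffineIndependent ℝ Δ.1) (hT : T ⊆ O k) (A : T) :
    positions ((hq.poseHomeomorph hk hΔ hT).symm A) = vertices q (entries A) := by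
  funext i
  change 0 + (1 : ℝ) • A.1.toEuclideanLin (q.1 i) = A.1.toEuclideanLin (q.1 i)
  rw [zero_add, one_smul]

theorem positions_eq_vertices (hq : IsNormalForm Δ q) (hk : 1 ≤ k)
    (hΔ : AffineIndependent ℝ Δ.1) (hT : T ⊆ O k) (x : ↥(simWithPose Δ T ∩ sphereConf k)) :
    positions x = vertices q (entries (hq.poseHomeomorph hk hΔ hT x)) := by
  rw [← hq.positions_poseHomeomorph_symm hk hΔ hT, Homeomorph.symm_apply_apply]

theorem entries_poseHomeomorph (hq : IsNormalForm Δ q) (hk : 1 ≤ k)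
    (hΔ : AffineIndependent ℝ Δ.1) (hT : T ⊆ O k) (x : ↥(simWithPose Δ T ∩ sphereConf k)) :
    entries (hq.poseHomeomorph hk hΔ hT x) = poseOfVertices Δ q (positions x) := by
  obtain ⟨A, rfl⟩ := (hq.poseHomeomorph hk hΔ hT).symm.surjective x
  exact (poseOfVertices_similarImage Δ q ⟨A, hT A.2⟩ 0).symm

/-- The retraction of the simplices with pose in `T` onto the inscribed ones that keeps the pose. -/
def retraction (hq : IsNormalForm Δ q) (hk : 1 ≤ k) (hΔ : AffineIndependent ℝ Δ.1)
    (hT : T ⊆ O k) : C(simWithPose Δ T, ↥(simWithPose Δ T ∩ sphereConf k)) :=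
  ((hq.poseHomeomorph hk hΔ hT).symm : C(T, _)).comp
    (poseMap Δ (mapsTo_pose_simWithPose Δ T))

/-- The homotopy, from the retraction of the simplices with pose in `T` onto the inscribed ones to
the identity, that keeps the pose and moves the center and the scale along segments. -/
def retractionHomotopy (hq : IsNormalForm Δ q) (hk : 1 ≤ k) (hΔ : AffineIndependent ℝ Δ.1)
    (hT : T ⊆ O k) :
    ((incl (simWithPose Δ T)).comp (hq.retraction hk hΔ hT)).Homotopy (ContinuousMap.id _) where
  toFun p := ⟨similarImage q ⟨pose Δ p.2, hT p.2.2.2⟩ ((p.1 : ℝ) • center Δ q p.2)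
      (1 - p.1 + p.1 * scale q p.2),
    similarImage_mem_sim hq.similar _ _ (add_nonneg (sub_nonneg.2 p.1.2.2)
      (mul_nonneg p.1.2.1 (scale_nonneg q _))),
    (hq.pose_similarImage _ _ _).symm ▸ p.2.2.2⟩
  continuous_toFun := by
    have h_pose := continuous_pose Δ
    have h_center := continuous_center Δ q
    have h_scale := continuous_scale q
    exact ((continuous_similarImage q).comp (by fun_prop : Continuous
      fun p : unitInterval × simWithPose Δ T => ((⟨pose Δ p.2, hT p.2.2.2⟩,
        (p.1 : ℝ) • center Δ q p.2, 1 - (p.1 : ℝ) + p.1 * scale q p.2) :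
          O k × E k × ℝ))).subtype_mk _
  map_zero_left x := Subtype.ext (by
    change similarImage q _ ((0 : ℝ) • _) (1 - (0 : ℝ) + 0 * _) = similarImage q _ 0 1
    rw [zero_smul, zero_mul, sub_zero, add_zero]
    rfl)
  map_one_left x := Subtype.ext (by
    change similarImage q _ ((1 : ℝ) • _) (1 - (1 : ℝ) + 1 * _) = x.1
    rw [one_smul, one_mul, sub_self, zero_add]
    exact (hq.eq_similarImage_of_mem_sim hk hΔ x.2.1).symm)

/-- The inclusion of the inscribed simplices with pose in `T` as a homotopy equivalence. -/
def inclHomotopyEquiv (hq : IsNormalForm Δ q) (hk : 1 ≤ k) (hΔ : AffineIndependent ℝ Δ.1)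
    (hT : T ⊆ O k) :
    ContinuousMap.HomotopyEquiv ↥(simWithPose Δ T ∩ sphereConf k) (simWithPose Δ T) where
  toFun := incl (simWithPose Δ T)
  invFun := hq.retraction hk hΔ hT
  left_inv := by
    have h_inv : (hq.retraction hk hΔ hT).comp (incl (simWithPose Δ T)) = ContinuousMap.id _ :=
      ContinuousMap.ext (hq.poseHomeomorph hk hΔ hT).symm_apply_apply
    rw [h_inv]
  right_inv := ⟨hq.retractionHomotopy hk hΔ hT⟩

end IsNormalForm

theorem poseResult_simWithPose (hk : 1 ≤ k) (hΔ : AffineIndependent ℝ Δ.1)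
    {W : Set (Matrix (Fin k) (Fin k) ℝ)} (hW : IsOpen W) (hT : T = O k ∩ W) :
    PoseResult Δ (simWithPose Δ T) T (mapsTo_pose_simWithPose Δ T) := by
  obtain ⟨q, hq⟩ := exists_isNormalForm hk hΔ
  have hTO : T ⊆ O k := hT ▸ Set.inter_subset_left
  let e := hq.poseHomeomorph hk hΔ hTO
  have h_target : IsSmoothSubmanifold (k * (k - 1) / 2) (entries : T → Fin k → Fin k → ℝ) :=
    hT ▸ isSmoothSubmanifold_entries hW
  exact {
    subset_interior := fun x hx => by
      rw [hq.eq_similarImage_of_mem_sphereConf hk hΔ hx.1.1 hx.2]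
      exact similarImage_mem_range_alpha q _ 0 one_pos
    source_manifold := h_target.of_homeomorph e (contDiff_vertices q) (contDiff_poseOfVertices Δ q)
      (hq.positions_eq_vertices hk hΔ hTO) fun x => (hq.entries_poseHomeomorph hk hΔ hTO x).symm
    target_manifold := h_target
    diffeo := ⟨isSmoothMap_of_contDiff (contDiff_poseOfVertices Δ q)
        (hq.entries_poseHomeomorph hk hΔ hTO), e.symm, e.symm_apply_apply, e.apply_symm_apply,
      isSmoothMap_of_contDiff (contDiff_vertices q) (hq.positions_poseHomeomorph_symm hk hΔ hTO)⟩
    homology_iso := fun n => isIso_Hmap_homeomorph n e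
    incl_iso := fun n => isIso_Hmap_homotopyEquiv n (hq.inclHomotopyEquiv hk hΔ hTO)
    top_class := fun c => by
      rw [← isTopClass_Hmap_homeomorph_iff _ e c, ← ModuleCat.comp_apply, ← Hmap_comp]
      rfl }

end PoseMap

section Determinant

variable {k : ℕ} {A : Matrix (Fin k) (Fin k) ℝ}

theorem det_eq_one_or_neg_one_of_mem_O (hA : A ∈ O k) : A.det = 1 ∨ A.det = -1 := by
  have h_det := congrArg Matrix.det ((Matrix.mem_orthogonalGroup_iff' (Fin k) ℝ).1 hA)
  rw [Matrix.det_mul, Matrix.det_transpose, Matrix.det_one] at h_det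
  exact mul_self_eq_one_iff.1 h_det

theorem mem_SO_iff_det_pos (hA : A ∈ O k) : A ∈ SO k ↔ 0 < A.det := by
  rw [SO, SetLike.mem_coe, Matrix.mem_specialOrthogonalGroup_iff,
    and_iff_right (SetLike.mem_coe.1 hA)]
  rcases det_eq_one_or_neg_one_of_mem_O hA with h | h <;> norm_num [h]

theorem SO_eq_O_inter_det_pos (k : ℕ) : SO k = O k ∩ {A | 0 < A.det} :=
  Set.ext fun _ => ⟨fun hA => ⟨hA.1, (mem_SO_iff_det_pos hA.1).1 hA⟩,
    fun hA => (mem_SO_iff_det_pos hA.1).2 hA.2⟩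

theorem O_diff_SO_eq_O_inter_det_neg (k : ℕ) : O k \ SO k = O k ∩ {A | A.det < 0} := by
  ext A
  refine and_congr_right fun hA => ?_
  change A ∉ SO k ↔ A.det < 0
  rw [mem_SO_iff_det_pos hA]
  rcases det_eq_one_or_neg_one_of_mem_O hA with h | h <;> norm_num [h]

theorem isOpen_det_pos (k : ℕ) : IsOpen {A : Matrix (Fin k) (Fin k) ℝ | 0 < A.det} :=
  isOpen_lt continuous_const continuous_id.matrix_det

theorem isOpen_det_neg (k : ℕ) : IsOpen {A : Matrix (Fin k) (Fin k) ℝ | A.det < 0} :=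
  isOpen_lt continuous_id.matrix_det continuous_const

end Determinant

end InscribedSimplex

end

open InscribedSimplex in
theorem mainTheorem8 (k : ℕ) (hk : 1 ≤ k) (Δ : Conf (k + 1) k) (hΔ : AffineIndependent ℝ Δ.1) :
    (∀ n : ℕ,
      IsIso (Hmap n (poseMap Δ
        ((mapsTo_pose Δ hΔ).mono_left (Set.inter_subset_left (t := sphereConf k))))) ∧
      IsIso (Hmap n (incl (sim Δ)))) ∧
    PoseResult Δ (simPlus Δ) (SO k) (mapsTo_pose_plus Δ) ∧
    PoseResult Δ (simMinus Δ) (O k \ SO k) (mapsTo_pose_minus Δ hΔ) := by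
  have h_all : PoseResult Δ (sim Δ) (O k) (mapsTo_pose Δ hΔ) := by
    simpa only [simWithPose_O hΔ] using
      poseResult_simWithPose hk hΔ isOpen_univ (Set.inter_univ (O k)).symm
  have h_plus := poseResult_simWithPose hk hΔ (isOpen_det_pos k) (SO_eq_O_inter_det_pos k)
  have h_minus : PoseResult Δ (simMinus Δ) (O k \ SO k) (mapsTo_pose_minus Δ hΔ) := by
    simpa only [simWithPose_O_diff_SO hΔ] using
      poseResult_simWithPose hk hΔ (isOpen_det_neg k) (O_diff_SO_eq_O_inter_det_neg k)
  exact ⟨fun n => ⟨h_all.homology_iso n, h_all.incl_iso n⟩, h_plus, h_minus⟩
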